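/- Let $\mathbb T=\{z\in\mathbb C:|z|=1\}$ and let $\mu$ be a Borel probability measure supported on $\mathbb T$ whose support $\operatorname{supp}\mu$ is an infinite set. Let $(\Phi_n)_{n\ge 0}$ be the monic polynomials, $\deg\Phi_n=n$, that are orthogonal with respect to $\langle f,g\rangle=\int_{\mathbb T} f(z)\overline{g(z)}\,d\mu(z)$, and let $\Phi_n^*(z)=z^n\,\overline{\Phi_n(1/\overline z)}$ be the reversed polynomials. For $w\in\mathbb T$ put $$f_n^{(1)}(z;w)=\frac{\Phi_n^*(w)\Phi_n(z)-\Phi_n(w)\Phi_n^*(z)}{i\,(zw)^{n/2}},\qquad z\in\mathbb C\setminus\{0\},\ n\ge 1,$$ where the determination of the half-integer powers is arbitrary, and let $\mathcal Z(w)=\{z\in\mathbb C\setminus\{0\}: f_n^{(1)}(z;w)=0\text{ for some } n\ge 1\}$. Suppose that $\operatorname{supp}\mu\ne\mathbb T$, let $\mathbb T\setminus\operatorname{supp}\mu=\bigcup_{k\in\mathcal A}C_k$ be the decomposition into connected components, and let $w_k\in C_k$ for every $k\in\mathcal A$. Then $$\operatorname{supp}\mu=\bigcap_{k\in\mathcal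 A}\mathcal Z(w_k)',$$ where $A'$ denotes the derived set (the set of accumulation points) of $A$ in $\mathbb C$. -/

import Mathlib

open MeasureTheory Polynomial

noncomputable section

/-- The sesquilinear form `⟨P, Q⟩ = ∫ P(z) conj (Q(z)) dμ(z)` on complex polynomials. -/
def polyInner (μ : Measure ℂ) (P Q : ℂ[X]) : ℂ :=
  ∫ z, P.eval z * (starRingEnd ℂ) (Q.eval z) ∂μ

/-- The monic orthogonal polynomials `Φ_n` of `μ`: the (unnormalised) Gram-Schmidt procedure
applied to `1, X, X ^ 2, …`. -/
def monicOrtho (μ : Measure ℂ) (n : ℕ) : ℂ[X] :=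
  X ^ n - ∑ k : Fin n,
    C (polyInner μ (X ^ n) (monicOrtho μ k) /
        polyInner μ (monicOrtho μ k) (monicOrtho μ k)) * monicOrtho μ k
termination_by n
decreasing_by exact k.isLt

/-- The reversed polynomial `Φ_n^*(z) = z ^ n * conj (Φ_n) (1 / z)`: the coefficients are conjugated
and listed in the opposite order. -/
def reversedOrtho (μ : Measure ℂ) (n : ℕ) : ℂ[X] :=
  ((monicOrtho μ n).map (starRingEnd ℂ)).reflect n

/-- `f_n^{(1)}(z; w) = (Φ_n^*(w) Φ_n(z) - Φ_n(w) Φ_n^*(z)) / (i (z w) ^ (n / 2))`, where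
`q n z` is the chosen determination of `(z w) ^ (1 / 2)`, so that `(z w) ^ (n / 2) = q n z ^ n`. -/
def semiOrthoFun (μ : Measure ℂ) (q : ℕ → ℂ → ℂ) (n : ℕ) (z w : ℂ) : ℂ :=
  ((reversedOrtho μ n).eval w * (monicOrtho μ n).eval z
    - (monicOrtho μ n).eval w * (reversedOrtho μ n).eval z) / (Complex.I * q n z ^ n)

/-- The set `Z(w)` of the zeros of all the functions `f_n^{(1)}(· ; w)`, `n ≥ 1`, which are
defined on the complex plane without the origin. -/
def zeroSet (μ : Measure ℂ) (q : ℕ → ℂ → ℂ) (w : ℂ) : Set ℂ :=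
  {z | z ≠ 0 ∧ ∃ n : ℕ, 1 ≤ n ∧ semiOrthoFun μ q n z w = 0}

/-- The set of the connected components of a subset `S` of the plane. -/
def componentsOf (S : Set ℂ) : Set (Set ℂ) :=
  {C | ∃ x ∈ S, C = connectedComponentIn S x}

end

/-! Let `N` be the numerator of `f_n^{(1)}(· ; w)`. It is orthogonal to `X, …, X ^ (n - 1)`, has
degree `n`, and equals its own reversal up to a factor.

Zeros avoid the gaps. If `N = (X - a)(X - b)Q` and `(z - a)(z - b) = c z g(z)` on the circle with
`g` real, then `0 = ⟨N, XQ⟩ = c ∫ g |Q|²`, so `g` must change sign on the support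
(`IsParaOrthogonal.false_of_nonneg`). With `b` the reflection of `a`, this puts the zeros on the
circle and makes them simple. With `a = w` and `b` in the same gap, `g` has constant sign on the
support, so `w` is the only zero in its gap. Hence no point of `C_k` is an accumulation point of
`Z(w_k)`.

Zeros accumulate at the support. The zeros of `N` are nodes of a positive quadrature of total mass 1
that is exact for `|p|²`, `deg p < n`. If a ball around a support point `x` contained no node for
arbitrarily large `n`, then `p = ((z + x)/2) ^ m` would make the mass near `x` vanish as `m → ∞`
(`measureReal_ball_mul_le`). The zero could still be `x` itself for every `n`; this is excluded
because consecutive numerators share only the zero `w` (`eval_paraOrtho_succ_ne_zero`). -/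

noncomputable section

open ComplexConjugate

/-! ### The sesquilinear form of a measure on the circle -/

section Form

variable {μ : Measure ℂ}

lemma ae_mem_circle (hμ : μ (Metric.sphere (0 : ℂ) 1)ᶜ = 0) :
    ∀ᵐ z ∂μ, z ∈ Metric.sphere (0 : ℂ) 1 := by
  rwa [ae_iff]

lemma integrable_of_circle [IsProbabilityMeasure μ] (hμ : μ (Metric.sphere (0 : ℂ) 1)ᶜ = 0)
    {E : Type*} [NormedAddCommGroup E] {f : ℂ → E} (hf : Continuous f) : Integrable f μ := by
  have h := (hf.continuousOn (s := Metric.sphere (0 : ℂ) 1)).integrableOn_compact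
    (μ := μ) (isCompact_sphere 0 1)
  rwa [IntegrableOn, Measure.restrict_eq_self_of_ae_mem (ae_mem_circle hμ)] at h

lemma integrable_eval_mul_conj [IsProbabilityMeasure μ]
    (hμ : μ (Metric.sphere (0 : ℂ) 1)ᶜ = 0) (P Q : ℂ[X]) :
    Integrable (fun z => P.eval z * conj (Q.eval z)) μ :=
  integrable_of_circle hμ (P.continuous.mul (Complex.continuous_conj.comp Q.continuous))

/-- `polyInner` as a sesquilinear map. -/
def polyForm (μ : Measure ℂ) [IsProbabilityMeasure μ]
    (hμ : μ (Metric.sphere (0 : ℂ) 1)ᶜ = 0) : ℂ[X] →ₗ[ℂ] ℂ[X] →ₗ⋆[ℂ] ℂ :=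
  LinearMap.mk₂'ₛₗ _ _ (polyInner μ)
    (fun P P' Q => by
      simp only [polyInner, eval_add, add_mul]
      exact integral_add (integrable_eval_mul_conj hμ P Q) (integrable_eval_mul_conj hμ P' Q))
    (fun c P Q => by
      simp only [polyInner, eval_smul, smul_eq_mul, mul_assoc, RingHom.id_apply]
      exact integral_const_mul _ _)
    (fun P Q Q' => by
      simp only [polyInner, eval_add, map_add, mul_add]
      exact integral_add (integrable_eval_mul_conj hμ P Q) (integrable_eval_mul_conj hμ P Q'))
    (fun c P Q => by
      simp only [polyInner, eval_smul, smul_eq_mul, map_mul, mul_left_comm _ (conj c)]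
      exact integral_const_mul _ _)

variable [IsProbabilityMeasure μ] (hμ : μ (Metric.sphere (0 : ℂ) 1)ᶜ = 0)

lemma polyForm_apply (P Q : ℂ[X]) :
    polyForm μ hμ P Q = ∫ z, P.eval z * conj (Q.eval z) ∂μ := rfl

lemma polyForm_conj (P Q : ℂ[X]) : conj (polyForm μ hμ P Q) = polyForm μ hμ Q P := by
  rw [polyForm_apply, polyForm_apply, ← integral_conj]
  simp [mul_comm]

lemma polyForm_eq_zero_comm (P Q : ℂ[X]) (h : polyForm μ hμ P Q = 0) :
    polyForm μ hμ Q P = 0 := by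
  rw [← polyForm_conj, h, map_zero]

/-- Since `μ` lives on the circle, `conj z * z = 1` may be used under the form; all shifts of
factors between its two arguments go through this. -/
lemma polyForm_congr {P Q P' Q' : ℂ[X]} {c : ℂ}
    (h : ∀ z ∈ Metric.sphere (0 : ℂ) 1,
      P.eval z * conj (Q.eval z) = c * (P'.eval z * conj (Q'.eval z))) :
    polyForm μ hμ P Q = c * polyForm μ hμ P' Q' := by
  rw [polyForm_apply, polyForm_apply, ← integral_const_mul]
  refine integral_congr_ae ?_
  filter_upwards [ae_mem_circle hμ] with z hz using h z hz

lemma polyForm_self (P : ℂ[X]) :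
    polyForm μ hμ P P = ((∫ z, ‖P.eval z‖ ^ 2 ∂μ : ℝ) : ℂ) := by
  rw [polyForm_apply, ← integral_complex_ofReal]
  congr 1
  ext z
  rw [Complex.mul_conj, Complex.normSq_eq_norm_sq]

omit [IsProbabilityMeasure μ] in
include hμ in
lemma support_subset_circle : μ.support ⊆ Metric.sphere (0 : ℂ) 1 :=
  Measure.support_subset_of_isClosed Metric.isClosed_sphere (ae_mem_circle hμ)

include hμ in
lemma eq_zero_on_support_of_integral_eq_zero {g : ℂ → ℝ} (hg : Continuous g)
    (hnn : ∀ z ∈ μ.support, 0 ≤ g z) (h0 : ∫ z, g z ∂μ = 0) : ∀ z ∈ μ.support, g z = 0 := by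
  intro z hz
  have hae : ∀ᵐ z ∂μ, z ∈ μ.support := by
    rw [ae_iff]; exact Measure.measure_compl_support
  have h1 : g =ᵐ[μ] 0 :=
    (integral_eq_zero_iff_of_nonneg_ae (by filter_upwards [hae] with z hz using hnn z hz)
      (integrable_of_circle hμ hg)).1 h0
  have h2 : μ {z | g z ≠ 0} = 0 := h1
  by_contra hne
  have h3 : {z | g z ≠ 0} ∈ nhds z := (isOpen_ne_fun hg continuous_const).mem_nhds hne
  rw [Measure.mem_support_iff_forall] at hz
  exact (hz _ h3).ne' h2

omit [IsProbabilityMeasure μ] in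
lemma polynomial_eq_zero_of_support {Q : ℂ[X]} (hinf : μ.support.Infinite) {s : Set ℂ}
    (hs : s.Finite) (h : ∀ z ∈ μ.support, z ∉ s → Q.eval z = 0) : Q = 0 :=
  Q.eq_zero_of_infinite_isRoot ((hinf.sdiff hs).mono fun z hz => h z hz.1 hz.2)

lemma eq_zero_of_polyForm_self (hinf : μ.support.Infinite) {P : ℂ[X]}
    (h : polyForm μ hμ P P = 0) : P = 0 := by
  rw [polyForm_self, Complex.ofReal_eq_zero] at h
  have := eq_zero_on_support_of_integral_eq_zero hμ (g := fun z => ‖P.eval z‖ ^ 2)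
    (by fun_prop) (fun _ _ => by positivity) h
  exact polynomial_eq_zero_of_support hinf Set.finite_empty fun z hz _ => by
    simpa using this z hz

/-- A polynomial that is orthogonal to the first `n` powers is orthogonal to all polynomials of
degree less than `n`. -/
lemma polyForm_eq_zero_of_degree_lt {P : ℂ[X]} {n : ℕ}
    (h : ∀ j < n, polyForm μ hμ P (X ^ j) = 0) {p : ℂ[X]} (hp : p.degree < n) :
    polyForm μ hμ P p = 0 := by
  rw [p.as_sum_support, map_sum]
  refine Finset.sum_eq_zero fun j hj => ?_
  have hjn : j < n := by exact_mod_cast (le_degree_of_mem_supp j hj).trans_lt hp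
  rw [← smul_X_eq_monomial, LinearMap.map_smulₛₗ, h j hjn, smul_zero]

end Form

/-! ### Orthogonal polynomials and their reversals -/

section Ortho

variable {μ : Measure ℂ}

lemma monicOrtho_degree (n : ℕ) :
    (monicOrtho μ n).Monic ∧ (monicOrtho μ n).natDegree = n := by
  induction n using Nat.strong_induction_on with
  | _ n ih =>
    have hlt : (∑ k : Fin n, C (polyInner μ (X ^ n) (monicOrtho μ k) /
        polyInner μ (monicOrtho μ k) (monicOrtho μ k)) * monicOrtho μ k).degree <
        ((X : ℂ[X]) ^ n).degree := by
      rw [degree_X_pow]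
      refine (degree_sum_le _ _).trans_lt ((Finset.sup_lt_iff (WithBot.bot_lt_coe n)).2 ?_)
      intro k _
      rw [← smul_eq_C_mul]
      refine (degree_smul_le _ _).trans_lt ?_
      rw [degree_eq_natDegree (ih k k.2).1.ne_zero, (ih k k.2).2]
      exact Nat.cast_lt.2 k.2
    rw [monicOrtho]
    have hm := (monic_X_pow (R := ℂ) n).sub_of_left hlt
    refine ⟨hm, ?_⟩
    refine natDegree_eq_of_degree_eq_some ?_
    rw [degree_sub_eq_left_of_degree_lt hlt, degree_X_pow]

lemma monicOrtho_monic (n : ℕ) : (monicOrtho μ n).Monic := (monicOrtho_degree n).1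

lemma natDegree_monicOrtho (n : ℕ) : (monicOrtho μ n).natDegree = n := (monicOrtho_degree n).2

lemma degree_monicOrtho (n : ℕ) : (monicOrtho μ n).degree = n := by
  rw [degree_eq_natDegree (monicOrtho_monic n).ne_zero, natDegree_monicOrtho]

variable [IsProbabilityMeasure μ] (hμ : μ (Metric.sphere (0 : ℂ) 1)ᶜ = 0)
  (hinf : μ.support.Infinite)

lemma monicOrtho_eq (n : ℕ) : monicOrtho μ n = X ^ n - ∑ k : Fin n,
    (polyForm μ hμ (X ^ n) (monicOrtho μ k) /
      polyForm μ hμ (monicOrtho μ k) (monicOrtho μ k)) • monicOrtho μ k := by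
  rw [monicOrtho]
  simp only [smul_eq_C_mul]
  rfl

include hinf in
lemma polyForm_monicOrtho_of_lt (n : ℕ) :
    ∀ m < n, polyForm μ hμ (monicOrtho μ n) (monicOrtho μ m) = 0 := by
  induction n using Nat.strong_induction_on with
  | _ n ih =>
    intro m hm
    rw [monicOrtho_eq hμ n, map_sub, map_sum, LinearMap.sub_apply, LinearMap.sum_apply,
      Finset.sum_eq_single ⟨m, hm⟩]
    · have : polyForm μ hμ (monicOrtho μ m) (monicOrtho μ m) ≠ 0 := fun h =>
        (monicOrtho_monic m).ne_zero (eq_zero_of_polyForm_self hμ hinf h)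
      rw [LinearMap.map_smul, LinearMap.smul_apply, smul_eq_mul, div_mul_cancel₀ _ this, sub_self]
    · intro k _ hk
      have hkm : (k : ℕ) ≠ m := fun h => hk (Fin.ext h)
      rw [LinearMap.map_smul, LinearMap.smul_apply]
      rcases lt_or_gt_of_ne hkm with h | h
      · rw [polyForm_eq_zero_comm _ _ _ (ih m hm k h), smul_zero]
      · rw [ih k k.2 m h, smul_zero]
    · simp

include hinf in
lemma polyForm_monicOrtho_X_pow {n j : ℕ} (hj : j < n) :
    polyForm μ hμ (monicOrtho μ n) (X ^ j) = 0 := by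
  have h := eq_add_of_sub_eq (monicOrtho_eq hμ j).symm
  rw [h, map_add, polyForm_monicOrtho_of_lt hμ hinf n j hj, map_sum, zero_add]
  refine Finset.sum_eq_zero fun k _ => ?_
  rw [LinearMap.map_smulₛₗ, polyForm_monicOrtho_of_lt hμ hinf n k (k.2.trans hj), smul_zero]

include hinf in
lemma polyForm_monicOrtho_of_degree_lt {n : ℕ} {p : ℂ[X]} (hp : p.degree < n) :
    polyForm μ hμ (monicOrtho μ n) p = 0 :=
  polyForm_eq_zero_of_degree_lt hμ (fun _ hj => polyForm_monicOrtho_X_pow hμ hinf hj) hp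

lemma conj_mul_self_of_mem_circle {z : ℂ} (hz : z ∈ Metric.sphere (0 : ℂ) 1) :
    conj z * z = 1 := by
  rw [mul_comm, Complex.mul_conj, Complex.normSq_eq_norm_sq, mem_sphere_zero_iff_norm.1 hz]
  simp

lemma ne_zero_of_mem_circle {z : ℂ} (hz : z ∈ Metric.sphere (0 : ℂ) 1) : z ≠ 0 := by
  rintro rfl; simp at hz

lemma conj_eq_inv_of_mem_circle {z : ℂ} (hz : z ∈ Metric.sphere (0 : ℂ) 1) :
    conj z = z⁻¹ :=
  eq_inv_of_mul_eq_one_left (conj_mul_self_of_mem_circle hz)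

include hμ hinf in
/-- The orthogonal polynomials have no zero on the unit circle. -/
lemma eval_monicOrtho_ne_zero (n : ℕ) {x : ℂ} (hx : x ∈ Metric.sphere (0 : ℂ) 1) :
    (monicOrtho μ n).eval x ≠ 0 := by
  intro h0
  obtain ⟨Q, hQ⟩ := dvd_iff_isRoot.2 h0
  have hΦ := (monicOrtho_monic (μ := μ) n).ne_zero
  have hQ0 : Q ≠ 0 := by rintro rfl; simp [hQ] at hΦ
  have hdeg : Q.degree < n := by
    rw [← degree_monicOrtho (μ := μ) n, hQ, degree_mul, degree_X_sub_C,
      degree_eq_natDegree hQ0]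
    exact_mod_cast (by omega : Q.natDegree < 1 + Q.natDegree)
  have h1 := polyForm_monicOrtho_of_degree_lt hμ hinf hdeg
  have h2 := polyForm_eq_zero_comm hμ _ _ h1
  have h3 : polyForm μ hμ (X * Q) (X * Q) = 1 * polyForm μ hμ Q Q :=
    polyForm_congr hμ fun z hz => by
      have := conj_mul_self_of_mem_circle hz
      simp only [eval_mul, eval_X, map_mul]
      linear_combination (eval z Q * conj (eval z Q)) * this
  -- Multiplication by `X` is isometric, so Pythagoras gives `‖Q‖² = ‖XQ‖² = ‖Φ_n‖² + ‖Q‖²`, which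
  -- forces `Φ_n = 0`.
  have h4 : X * Q = monicOrtho μ n + x • Q := by rw [hQ, smul_eq_C_mul]; ring
  rw [h4] at h3
  simp only [map_add, LinearMap.add_apply, LinearMap.map_smulₛₗ, LinearMap.smul_apply, h1, h2,
    smul_eq_mul] at h3
  refine hΦ (eq_zero_of_polyForm_self hμ hinf ?_)
  have := conj_mul_self_of_mem_circle hx
  linear_combination h3 - polyForm μ hμ Q Q * this

omit [IsProbabilityMeasure μ] in
lemma eval_reversedOrtho (n : ℕ) {z : ℂ} (hz : z ≠ 0) :
    (reversedOrtho μ n).eval z = z ^ n * conj ((monicOrtho μ n).eval (conj z)⁻¹) := by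
  let := invertibleOfNonzero (inv_ne_zero hz)
  have h := eval₂_reflect_mul_pow (RingHom.id ℂ) z⁻¹ n
    ((monicOrtho μ n).map (starRingEnd ℂ)) (by rw [natDegree_map, natDegree_monicOrtho])
  rw [invOf_eq_inv, inv_inv, ← eval, inv_pow, mul_inv_eq_iff_eq_mul₀ (pow_ne_zero n hz)] at h
  rw [reversedOrtho, h, mul_comm, ← eval, ← eval₂_at_apply, eval_map, map_inv₀, Complex.conj_conj]

omit [IsProbabilityMeasure μ] in
lemma eval_reversedOrtho_circle (n : ℕ) {z : ℂ} (hz : z ∈ Metric.sphere (0 : ℂ) 1) :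
    (reversedOrtho μ n).eval z = z ^ n * conj ((monicOrtho μ n).eval z) := by
  rw [eval_reversedOrtho n (ne_zero_of_mem_circle hz), conj_eq_inv_of_mem_circle hz, inv_inv]

include hinf in
lemma polyForm_reversedOrtho_X_pow {n j : ℕ} (hj : j < n) :
    polyForm μ hμ (reversedOrtho μ n) (X ^ (j + 1)) = 0 := by
  have h : polyForm μ hμ (reversedOrtho μ n) (X ^ (j + 1)) =
      1 * polyForm μ hμ (X ^ (n - (j + 1))) (monicOrtho μ n) :=
    polyForm_congr hμ fun z hz => by
      obtain ⟨k, rfl⟩ : ∃ k, n = k + (j + 1) := ⟨n - (j + 1), by omega⟩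
      have := congrArg (· ^ (j + 1)) (conj_mul_self_of_mem_circle hz)
      simp only [mul_pow, one_pow] at this
      rw [eval_reversedOrtho_circle _ hz]
      simp only [eval_pow, eval_X, map_pow, Nat.add_sub_cancel, pow_add z k]
      linear_combination z ^ k * conj (eval z (monicOrtho μ (k + (j + 1)))) * this
  rw [h, polyForm_eq_zero_comm _ _ _ (polyForm_monicOrtho_X_pow hμ hinf (by omega)), mul_zero]

omit [IsProbabilityMeasure μ] in
lemma natDegree_reversedOrtho_le (n : ℕ) : (reversedOrtho μ n).natDegree ≤ n := by
  refine natDegree_reflect_le.trans ?_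
  rw [natDegree_map, natDegree_monicOrtho, max_self]

end Ortho

/-! ### Para-orthogonal polynomials: degree and location of zeros -/

section Para

variable {μ : Measure ℂ}

/-- The numerator of `f_n^{(1)}(· ; w)`. -/
def paraOrtho (μ : Measure ℂ) (n : ℕ) (w : ℂ) : ℂ[X] :=
  (reversedOrtho μ n).eval w • monicOrtho μ n - (monicOrtho μ n).eval w • reversedOrtho μ n

lemma eval_paraOrtho (n : ℕ) (w z : ℂ) : (paraOrtho μ n w).eval z =
    (reversedOrtho μ n).eval w * (monicOrtho μ n).eval z
      - (monicOrtho μ n).eval w * (reversedOrtho μ n).eval z := by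
  simp [paraOrtho]

lemma eval_paraOrtho_self (n : ℕ) (w : ℂ) : (paraOrtho μ n w).eval w = 0 := by
  rw [eval_paraOrtho]; ring

lemma natDegree_paraOrtho_le (n : ℕ) (w : ℂ) : (paraOrtho μ n w).natDegree ≤ n :=
  (natDegree_sub_le _ _).trans (max_le
    ((natDegree_smul_le _ _).trans (natDegree_monicOrtho n).le)
    ((natDegree_smul_le _ _).trans (natDegree_reversedOrtho_le n)))

/-- For `w` on the circle, `N = -w ^ n N^*`, so the zeros are symmetric about the circle. -/
lemma eval_paraOrtho_inv_conj (n : ℕ) {w z : ℂ} (hw : w ∈ Metric.sphere (0 : ℂ) 1) (hz : z ≠ 0)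
    (h : (paraOrtho μ n w).eval z = 0) : (paraOrtho μ n w).eval (conj z)⁻¹ = 0 := by
  have hy : (conj z)⁻¹ ≠ 0 := inv_ne_zero ((_root_.map_ne_zero _).2 hz)
  have h' := congrArg conj h
  have e1 : conj w ^ n * w ^ n = 1 := by rw [← mul_pow, conj_mul_self_of_mem_circle hw, one_pow]
  have e2 : conj z ^ n * ((conj z)⁻¹) ^ n = 1 := by
    rw [← mul_pow, mul_inv_cancel₀ ((_root_.map_ne_zero _).2 hz), one_pow]
  rw [eval_paraOrtho, eval_reversedOrtho_circle n hw, eval_reversedOrtho n hz] at h'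
  rw [eval_paraOrtho, eval_reversedOrtho_circle n hw, eval_reversedOrtho n hy]
  simp only [map_inv₀, map_sub, map_mul, map_pow, Complex.conj_conj, map_zero, inv_inv] at h' ⊢
  linear_combination (-(w ^ n * ((conj z)⁻¹) ^ n)) * h'
    + (eval w (monicOrtho μ n) * ((conj z)⁻¹) ^ n * conj (eval z (monicOrtho μ n))) * e1
    - w ^ n * conj (eval w (monicOrtho μ n)) * eval (conj z)⁻¹ (monicOrtho μ n) * e2

lemma coeff_monicOrtho_self (n : ℕ) : (monicOrtho μ n).coeff n = 1 := by
  have := monicOrtho_monic (μ := μ) n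
  rwa [Monic, leadingCoeff, natDegree_monicOrtho] at this

lemma coeff_zero_reversedOrtho (n : ℕ) : (reversedOrtho μ n).coeff 0 = 1 := by
  rw [reversedOrtho, coeff_reflect, revAt_le (Nat.zero_le n), Nat.sub_zero, coeff_map,
    coeff_monicOrtho_self, map_one]

lemma coeff_reversedOrtho_self (n : ℕ) :
    (reversedOrtho μ n).coeff n = conj ((monicOrtho μ n).coeff 0) := by
  rw [reversedOrtho, coeff_reflect, revAt_le le_rfl, Nat.sub_self, coeff_map]

lemma coeff_zero_paraOrtho (n : ℕ) {w : ℂ} (hw : w ∈ Metric.sphere (0 : ℂ) 1) :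
    (paraOrtho μ n w).coeff 0 = -w ^ n * conj ((paraOrtho μ n w).coeff n) := by
  have e1 : conj w ^ n * w ^ n = 1 := by rw [← mul_pow, conj_mul_self_of_mem_circle hw, one_pow]
  simp only [paraOrtho, coeff_sub, coeff_smul, smul_eq_mul, coeff_reversedOrtho_self,
    coeff_monicOrtho_self, coeff_zero_reversedOrtho, eval_reversedOrtho_circle n hw, map_sub,
    map_mul, map_pow, Complex.conj_conj, map_one]
  linear_combination (eval w (monicOrtho μ n)) * e1

variable [IsProbabilityMeasure μ] (hμ : μ (Metric.sphere (0 : ℂ) 1)ᶜ = 0)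
  (hinf : μ.support.Infinite)

include hinf in
lemma polyForm_reversedOrtho_X_mul {n : ℕ} {Q : ℂ[X]} (hQ : Q.degree < n) :
    polyForm μ hμ (reversedOrtho μ n) (X * Q) = 0 := by
  rw [Q.as_sum_support, Finset.mul_sum, map_sum]
  refine Finset.sum_eq_zero fun j hj => ?_
  have hjn : j < n := by exact_mod_cast (le_degree_of_mem_supp j hj).trans_lt hQ
  rw [X_mul_monomial, ← smul_X_eq_monomial, LinearMap.map_smulₛₗ,
    polyForm_reversedOrtho_X_pow hμ hinf hjn, smul_zero]

/-- `N` is orthogonal to `X, X ^ 2, …, X ^ (n - 1)`. -/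
def IsParaOrthogonal (μ : Measure ℂ) [IsProbabilityMeasure μ]
    (hμ : μ (Metric.sphere (0 : ℂ) 1)ᶜ = 0) (n : ℕ) (N : ℂ[X]) : Prop :=
  ∀ Q : ℂ[X], Q.natDegree + 2 ≤ n → polyForm μ hμ N (X * Q) = 0

include hinf in
lemma isParaOrthogonal_paraOrtho (n : ℕ) (w : ℂ) :
    IsParaOrthogonal μ hμ n (paraOrtho μ n w) := by
  intro Q hQ
  have h1 : Q.degree < n := degree_le_natDegree.trans_lt (Nat.cast_lt.2 (by omega))
  have h2 : degree (X * Q) < (n : WithBot ℕ) := by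
    refine degree_le_natDegree.trans_lt (Nat.cast_lt.2 (natDegree_mul_le.trans_lt ?_))
    rw [natDegree_X]
    omega
  rw [paraOrtho, map_sub, LinearMap.sub_apply, LinearMap.map_smul, LinearMap.map_smul,
    LinearMap.smul_apply, LinearMap.smul_apply, polyForm_reversedOrtho_X_mul hμ hinf h1,
    polyForm_monicOrtho_of_degree_lt hμ hinf h2, smul_zero, smul_zero, sub_zero]

lemma eval_reversedOrtho_ne_zero (n : ℕ) {w : ℂ} (hμ : μ (Metric.sphere (0 : ℂ) 1)ᶜ = 0)
    (hinf : μ.support.Infinite) (hw : w ∈ Metric.sphere (0 : ℂ) 1) :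
    (reversedOrtho μ n).eval w ≠ 0 := by
  rw [eval_reversedOrtho_circle n hw]
  exact mul_ne_zero (pow_ne_zero _ (ne_zero_of_mem_circle hw))
    ((_root_.map_ne_zero _).2 (eval_monicOrtho_ne_zero hμ hinf n hw))

include hμ hinf in
-- If `N = 0`, pairing with `X ^ n`, to which `Φ_n^*` is orthogonal when `n ≥ 1`, makes `Φ_n`
-- orthogonal to `X ^ n` and hence to itself. For `n = 0` the numerator does vanish.
lemma paraOrtho_ne_zero {n : ℕ} (hn : 1 ≤ n) {w : ℂ} (hw : w ∈ Metric.sphere (0 : ℂ) 1) :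
    paraOrtho μ n w ≠ 0 := by
  intro h0
  have hu := eval_reversedOrtho_ne_zero n hμ hinf hw
  refine (monicOrtho_monic (μ := μ) n).ne_zero (eq_zero_of_polyForm_self hμ hinf ?_)
  refine polyForm_eq_zero_of_degree_lt hμ (n := n + 1) (fun j hj => ?_) ?_
  · rcases Nat.lt_succ_iff_lt_or_eq.1 hj with h | rfl
    · exact polyForm_monicOrtho_X_pow hμ hinf h
    · have h1 := congrArg (fun P => polyForm μ hμ P (X ^ j)) h0
      obtain ⟨k, rfl⟩ : ∃ k, j = k + 1 := ⟨j - 1, by omega⟩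
      simp only [paraOrtho, map_sub, LinearMap.sub_apply, LinearMap.map_smul,
        LinearMap.smul_apply, polyForm_reversedOrtho_X_pow hμ hinf (Nat.lt_succ_self k),
        smul_zero, sub_zero, map_zero, LinearMap.zero_apply] at h1
      exact (smul_eq_zero.1 h1).resolve_left hu
  · rw [degree_monicOrtho]; exact Nat.cast_lt.2 (Nat.lt_succ_self n)

include hμ hinf in
-- By the self-reversal symmetry the top and constant coefficients vanish together. Then `N = XQ`
-- with `deg Q ≤ n - 2`, so `N` is orthogonal to itself.
lemma coeff_paraOrtho_ne_zero {n : ℕ} (hn : 1 ≤ n) {w : ℂ} (hw : w ∈ Metric.sphere (0 : ℂ) 1) :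
    (paraOrtho μ n w).coeff n ≠ 0 := by
  intro h0
  have hN := paraOrtho_ne_zero hμ hinf hn hw
  have hc0 : (paraOrtho μ n w).coeff 0 = 0 := by
    rw [coeff_zero_paraOrtho n hw, h0, map_zero, mul_zero]
  have hlt : (paraOrtho μ n w).natDegree < n :=
    lt_of_le_of_ne (natDegree_paraOrtho_le n w) fun h => hN (by
      rwa [← leadingCoeff_eq_zero, leadingCoeff, h])
  obtain ⟨Q, hQ⟩ := X_dvd_iff.2 hc0
  have hQ0 : Q ≠ 0 := by rintro rfl; simp [hQ] at hN
  have hd : (paraOrtho μ n w).natDegree = Q.natDegree + 1 := by rw [hQ, natDegree_X_mul hQ0]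
  have := isParaOrthogonal_paraOrtho hμ hinf n w Q (by omega)
  rw [← hQ] at this
  exact hN (eq_zero_of_polyForm_self hμ hinf this)

include hμ hinf in
lemma natDegree_paraOrtho {n : ℕ} (hn : 1 ≤ n) {w : ℂ} (hw : w ∈ Metric.sphere (0 : ℂ) 1) :
    (paraOrtho μ n w).natDegree = n :=
  natDegree_eq_of_le_of_coeff_ne_zero (natDegree_paraOrtho_le n w)
    (coeff_paraOrtho_ne_zero hμ hinf hn hw)

variable {hμ}

include hinf in
/-- A para-orthogonal polynomial has no quadratic factor that is, on the circle, a monomial times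
a function of constant sign on the support. -/
lemma IsParaOrthogonal.false_of_nonneg {n : ℕ} {N Q : ℂ[X]} (hN : N ≠ 0)
    (hdeg : N.natDegree ≤ n) (h : IsParaOrthogonal μ hμ n N) {a b c : ℂ}
    (hfac : N = (X - C a) * (X - C b) * Q) {g : ℂ → ℝ} (hg : Continuous g)
    (heq : ∀ z ∈ Metric.sphere (0 : ℂ) 1, (z - a) * (z - b) = c * (z * g z))
    (hc : c ≠ 0) (hnn : ∀ z ∈ μ.support, 0 ≤ g z) : False := by
  have hQ : Q ≠ 0 := by rintro rfl; simp [hfac] at hN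
  have hd : N.natDegree = 2 + Q.natDegree := by
    rw [hfac, natDegree_mul (mul_ne_zero (X_sub_C_ne_zero a) (X_sub_C_ne_zero b)) hQ,
      natDegree_mul (X_sub_C_ne_zero a) (X_sub_C_ne_zero b), natDegree_X_sub_C,
      natDegree_X_sub_C]
  have h1 := h Q (by omega)
  have h2 : polyForm μ hμ N (X * Q) = c * ((∫ z, g z * ‖Q.eval z‖ ^ 2 ∂μ : ℝ) : ℂ) := by
    rw [polyForm_apply, ← integral_complex_ofReal, ← integral_const_mul]
    refine integral_congr_ae ?_
    filter_upwards [ae_mem_circle hμ] with z hz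
    have e1 := conj_mul_self_of_mem_circle hz
    have e2 : eval z Q * conj (eval z Q) = (‖eval z Q‖ ^ 2 : ℝ) := by
      rw [Complex.mul_conj, Complex.normSq_eq_norm_sq]
    simp only [hfac, eval_mul, eval_sub, eval_X, eval_C, map_mul, heq z hz,
      Complex.ofReal_mul, ← e2]
    linear_combination (c * g z * eval z Q * conj (eval z Q)) * e1
  rw [h1, eq_comm, mul_eq_zero, or_iff_right hc, Complex.ofReal_eq_zero] at h2
  have h3 := eq_zero_on_support_of_integral_eq_zero hμ
    (g := fun z => g z * ‖Q.eval z‖ ^ 2) (by fun_prop)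
    (fun z hz => mul_nonneg (hnn z hz) (by positivity)) h2
  refine hQ (polynomial_eq_zero_of_support hinf (s := {a, b}) (Set.toFinite _) fun z hz hab => ?_)
  rcases mul_eq_zero.1 (h3 z hz) with h4 | h4
  · have := heq z (support_subset_circle hμ hz)
    rw [h4, Complex.ofReal_zero, mul_zero, mul_zero, mul_eq_zero, sub_eq_zero, sub_eq_zero] at this
    exact absurd this hab
  · simpa using h4

include hinf in
-- On the circle `(z - a)(z - 1 / conj a) = -(1 / conj a) z |z - a|²`. This excludes symmetric pairs
-- off the circle and double zeros on it alike.
lemma IsParaOrthogonal.not_dvd {n : ℕ} {N : ℂ[X]} (hN : N ≠ 0)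
    (hdeg : N.natDegree ≤ n) (h : IsParaOrthogonal μ hμ n N) {a : ℂ} (ha : a ≠ 0) :
    ¬ (X - C a) * (X - C (conj a)⁻¹) ∣ N := by
  rintro ⟨Q, hQ⟩
  have ha' : conj a ≠ 0 := (_root_.map_ne_zero _).2 ha
  refine h.false_of_nonneg hinf hN hdeg hQ (c := -(conj a)⁻¹) (g := fun z => ‖z - a‖ ^ 2)
    (by fun_prop) (fun z hz => ?_) (neg_ne_zero.2 (inv_ne_zero ha')) fun _ _ => by positivity
  have e1 := conj_mul_self_of_mem_circle hz
  have e2 : (z - a) * (conj z - conj a) = (‖z - a‖ ^ 2 : ℝ) := by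
    rw [← map_sub, Complex.mul_conj, Complex.normSq_eq_norm_sq]
  rw [← e2]
  field_simp
  linear_combination (z - a) * e1

variable (hμ)

lemma mul_dvd_of_isRoot {N : ℂ[X]} {a b : ℂ} (hab : a ≠ b) (ha : N.eval a = 0)
    (hb : N.eval b = 0) : (X - C a) * (X - C b) ∣ N := by
  refine IsCoprime.mul_dvd (isCoprime_X_sub_C_of_isUnit_sub ?_) (dvd_iff_isRoot.2 ha)
    (dvd_iff_isRoot.2 hb)
  exact (sub_ne_zero.2 hab).isUnit

include hμ hinf in
lemma mem_circle_of_eval_paraOrtho {n : ℕ} (hn : 1 ≤ n) {w z : ℂ}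
    (hw : w ∈ Metric.sphere (0 : ℂ) 1) (hz0 : z ≠ 0) (hz : (paraOrtho μ n w).eval z = 0) :
    z ∈ Metric.sphere (0 : ℂ) 1 := by
  by_contra hcirc
  refine (isParaOrthogonal_paraOrtho hμ hinf n w).not_dvd hinf (paraOrtho_ne_zero hμ hinf hn hw)
    (natDegree_paraOrtho_le n w) hz0 (mul_dvd_of_isRoot (fun h => hcirc ?_) hz
      (eval_paraOrtho_inv_conj n hw hz0 hz))
  have h1 : z * conj z = 1 := by
    nth_rewrite 1 [h]
    exact inv_mul_cancel₀ ((_root_.map_ne_zero _).2 hz0)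
  rw [Complex.mul_conj, Complex.normSq_eq_norm_sq] at h1
  rw [mem_sphere_zero_iff_norm]
  have h2 : ‖z‖ ^ 2 = 1 := by exact_mod_cast h1
  exact (pow_eq_one_iff_of_nonneg (norm_nonneg z) two_ne_zero).1 h2

include hμ hinf in
lemma eval_zero_paraOrtho_ne_zero {n : ℕ} (hn : 1 ≤ n) {w : ℂ}
    (hw : w ∈ Metric.sphere (0 : ℂ) 1) : (paraOrtho μ n w).eval 0 ≠ 0 := by
  rw [← coeff_zero_eq_eval_zero, coeff_zero_paraOrtho n hw]
  exact mul_ne_zero (neg_ne_zero.2 (pow_ne_zero n (ne_zero_of_mem_circle hw)))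
    ((_root_.map_ne_zero _).2 (coeff_paraOrtho_ne_zero hμ hinf hn hw))

end Para

/-! ### Signs relative to a chord -/

section Chord

/-- A trigonometric polynomial vanishing at `a` and `b`, real on the circle when `s ^ 2 = a * b`. -/
def chordFun (a b s u : ℂ) : ℝ := ((u - a) * (u - b) * conj u * conj s).re

lemma continuous_chordFun (a b s : ℂ) : Continuous (chordFun a b s) := by
  unfold chordFun
  fun_prop

lemma mem_circle_of_sq_eq {a b s : ℂ} (ha : a ∈ Metric.sphere (0 : ℂ) 1)
    (hb : b ∈ Metric.sphere (0 : ℂ) 1) (hs : s ^ 2 = a * b) : s ∈ Metric.sphere (0 : ℂ) 1 := by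
  rw [mem_sphere_zero_iff_norm] at *
  have h := congrArg norm hs
  rw [norm_pow, norm_mul, ha, hb, mul_one] at h
  exact (pow_eq_one_iff_of_nonneg (norm_nonneg s) two_ne_zero).1 h

lemma coe_chordFun {a b s u : ℂ} (ha : a ∈ Metric.sphere (0 : ℂ) 1)
    (hb : b ∈ Metric.sphere (0 : ℂ) 1) (hu : u ∈ Metric.sphere (0 : ℂ) 1) (hs : s ^ 2 = a * b) :
    (chordFun a b s u : ℂ) = (u - a) * (u - b) * u⁻¹ * s⁻¹ := by
  have hs' := mem_circle_of_sq_eq ha hb hs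
  have ha0 := ne_zero_of_mem_circle ha
  have hb0 := ne_zero_of_mem_circle hb
  have hu0 := ne_zero_of_mem_circle hu
  have hs0 := ne_zero_of_mem_circle hs'
  rw [chordFun, conj_eq_inv_of_mem_circle hu, conj_eq_inv_of_mem_circle hs']
  refine Complex.conj_eq_iff_re.1 ?_
  simp only [map_mul, map_sub, map_inv₀, conj_eq_inv_of_mem_circle hu,
    conj_eq_inv_of_mem_circle hs', conj_eq_inv_of_mem_circle ha, conj_eq_inv_of_mem_circle hb,
    inv_inv]
  field_simp
  rw [hs]
  ring

/-- Both sides equal `(u - a)(u - b)(v - a)(v - b) / (a b u v)`. In words: `u, v` are separated by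
the chord `ab` exactly when `a, b` are separated by the chord `uv`. -/
lemma chordFun_mul_chordFun {a b s u v t : ℂ} (ha : a ∈ Metric.sphere (0 : ℂ) 1)
    (hb : b ∈ Metric.sphere (0 : ℂ) 1) (hu : u ∈ Metric.sphere (0 : ℂ) 1)
    (hv : v ∈ Metric.sphere (0 : ℂ) 1) (hs : s ^ 2 = a * b) (ht : t ^ 2 = u * v) :
    chordFun a b s u * chordFun a b s v = chordFun u v t a * chordFun u v t b := by
  have hs0 := ne_zero_of_mem_circle (mem_circle_of_sq_eq ha hb hs)
  have ht0 := ne_zero_of_mem_circle (mem_circle_of_sq_eq hu hv ht)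
  have ha0 := ne_zero_of_mem_circle ha
  have hb0 := ne_zero_of_mem_circle hb
  have hu0 := ne_zero_of_mem_circle hu
  have hv0 := ne_zero_of_mem_circle hv
  rw [← Complex.ofReal_inj, Complex.ofReal_mul, Complex.ofReal_mul, coe_chordFun ha hb hu hs,
    coe_chordFun ha hb hv hs, coe_chordFun hu hv ha ht, coe_chordFun hu hv hb ht]
  field_simp
  rw [hs, ht]
  ring

lemma mul_pos_of_isPreconnected {K : Set ℂ} (hK : IsPreconnected K) {g : ℂ → ℝ}
    (hg : Continuous g) (h0 : ∀ z ∈ K, g z ≠ 0) {u v : ℂ} (hu : u ∈ K) (hv : v ∈ K) :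
    0 < g u * g v := by
  have hord := (hK.image g hg.continuousOn).ordConnected
  have hz : (0 : ℝ) ∉ g '' K := fun ⟨z, hz, h⟩ => h0 z hz h
  by_contra! hle
  rcases mul_nonpos_iff.1 hle with h | h
  · exact hz (hord.out (Set.mem_image_of_mem g hv) (Set.mem_image_of_mem g hu) ⟨h.2, h.1⟩)
  · exact hz (hord.out (Set.mem_image_of_mem g hu) (Set.mem_image_of_mem g hv) h)

end Chord

/-! ### Zeros in gaps, quadrature, and consecutive indices -/

section Zeros

variable {μ : Measure ℂ} [IsProbabilityMeasure μ] (hμ : μ (Metric.sphere (0 : ℂ) 1)ᶜ = 0)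
  (hinf : μ.support.Infinite)

include hμ hinf in
/-- In a connected subset of the circle off the support, the only zero is the prescribed one. -/
lemma eq_of_eval_paraOrtho_of_isPreconnected {n : ℕ} (hn : 1 ≤ n) {K : Set ℂ}
    (hK : IsPreconnected K) (hKS : K ⊆ Metric.sphere (0 : ℂ) 1 \ μ.support) {w z : ℂ} (hw : w ∈ K)
    (hz : z ∈ K) (h : (paraOrtho μ n w).eval z = 0) : z = w := by
  by_contra hne
  have hwc := (hKS hw).1
  have hzc := (hKS hz).1
  obtain ⟨Q, hQ⟩ := mul_dvd_of_isRoot (Ne.symm hne) (eval_paraOrtho_self n w) h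
  obtain ⟨s, hs⟩ := IsAlgClosed.exists_pow_nat_eq (w * z) two_pos
  have hs0 := ne_zero_of_mem_circle (mem_circle_of_sq_eq hwc hzc hs)
  have hN := paraOrtho_ne_zero hμ hinf hn hwc
  have hd := natDegree_paraOrtho_le (μ := μ) n w
  have hpara := isParaOrthogonal_paraOrtho hμ hinf n w
  have heq : ∀ u ∈ Metric.sphere (0 : ℂ) 1,
      (u - w) * (u - z) = s * (u * (chordFun w z s u : ℂ)) := fun u hu => by
    rw [coe_chordFun hwc hzc hu hs]
    have := ne_zero_of_mem_circle hu
    field_simp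
  have h1 : ∃ a ∈ μ.support, chordFun w z s a < 0 := by
    by_contra! hnn
    exact hpara.false_of_nonneg hinf hN hd hQ (continuous_chordFun w z s) heq hs0 hnn
  have h2 : ∃ b ∈ μ.support, 0 < chordFun w z s b := by
    by_contra! hnp
    refine hpara.false_of_nonneg hinf hN hd hQ (continuous_chordFun w z s).neg (c := -s)
      (fun u hu => ?_) (neg_ne_zero.2 hs0) fun u hu => neg_nonneg.2 (hnp u hu)
    rw [heq u hu]
    simp only [Pi.neg_apply, Complex.ofReal_neg]
    ring
  obtain ⟨a, ha, ha'⟩ := h1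
  obtain ⟨b, hb, hb'⟩ := h2
  have hac := support_subset_circle hμ ha
  have hbc := support_subset_circle hμ hb
  obtain ⟨t, ht⟩ := IsAlgClosed.exists_pow_nat_eq (a * b) two_pos
  have ht0 := ne_zero_of_mem_circle (mem_circle_of_sq_eq hac hbc ht)
  -- The chord through the support points `a, b` does not separate `w` from `z`, since `K` is
  -- connected and misses both endpoints. By reciprocity `a, b` lie on the same side of the chord
  -- `wz`, against the choice of signs.
  have hpos := mul_pos_of_isPreconnected hK (continuous_chordFun a b t) (fun u hu h0 => by
    have h3 := coe_chordFun hac hbc (hKS hu).1 ht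
    rw [h0, Complex.ofReal_zero, eq_comm] at h3
    have h4 := ne_zero_of_mem_circle (hKS hu).1
    simp only [mul_eq_zero, inv_eq_zero, h4, ht0, or_false, sub_eq_zero] at h3
    rcases h3 with rfl | rfl
    exacts [(hKS hu).2 ha, (hKS hu).2 hb]) hw hz
  rw [chordFun_mul_chordFun hac hbc hwc hzc ht hs] at hpos
  exact absurd hpos (mul_neg_of_neg_of_pos ha' hb').not_gt

variable {hμ} in
-- On the circle `conj (z - a) = -conj a * conj z * (z - a)`, so the factor of `p` at `a` can be
-- moved over to `L`, restoring `N`.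
lemma IsParaOrthogonal.polyForm_eq_zero {n : ℕ} {N L p : ℂ[X]} (h : IsParaOrthogonal μ hμ n N)
    {a : ℂ} (ha : a ∈ Metric.sphere (0 : ℂ) 1) (hN : N = (X - C a) * L) (hp : p.degree < n)
    (hpa : p.eval a = 0) : polyForm μ hμ L p = 0 := by
  rcases eq_or_ne p 0 with rfl | hp0
  · exact map_zero _
  obtain ⟨r, rfl⟩ := dvd_iff_isRoot.2 hpa
  have hr : r ≠ 0 := right_ne_zero_of_mul hp0
  have hlt := (natDegree_lt_iff_degree_lt hp0).2 hp
  rw [natDegree_mul (X_sub_C_ne_zero a) hr, natDegree_X_sub_C] at hlt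
  have h1 : polyForm μ hμ L ((X - C a) * r) = (-conj a) * polyForm μ hμ N (X * r) :=
    polyForm_congr hμ fun z hz => by
      have e1 := conj_mul_self_of_mem_circle hz
      have e2 := conj_mul_self_of_mem_circle ha
      simp only [hN, eval_mul, eval_sub, eval_X, eval_C, map_mul, map_sub]
      linear_combination (conj a * eval z L * conj (eval z r)) * e1
        - (conj z * eval z L * conj (eval z r)) * e2
  rw [h1, h r (by omega), mul_zero]

variable {hμ} in
-- Up to a constant, `N / (X - a)` is the reproducing kernel at `a` for polynomials of degree less
-- than `n`.
lemma IsParaOrthogonal.polyForm_eq {n : ℕ} {N L p : ℂ[X]} (h : IsParaOrthogonal μ hμ n N)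
    (hn : 1 ≤ n) {a : ℂ} (ha : a ∈ Metric.sphere (0 : ℂ) 1) (hN : N = (X - C a) * L)
    (hp : p.degree < n) : polyForm μ hμ L p = conj (p.eval a) * polyForm μ hμ L 1 := by
  have h1 : (p - p.eval a • (1 : ℂ[X])).degree < n :=
    (degree_sub_le _ _).trans_lt (max_lt hp ((degree_smul_le _ _).trans_lt (by
      rw [degree_one]; exact Nat.cast_lt.2 hn)))
  have h2 := h.polyForm_eq_zero ha hN h1 (by simp)
  rwa [map_sub, LinearMap.map_smulₛₗ, sub_eq_zero] at h2

include hμ hinf in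
lemma nodup_roots_paraOrtho {n : ℕ} (hn : 1 ≤ n) {w : ℂ} (hw : w ∈ Metric.sphere (0 : ℂ) 1) :
    (paraOrtho μ n w).roots.Nodup := by
  have hN := paraOrtho_ne_zero hμ hinf hn hw
  refine Multiset.nodup_iff_count_le_one.2 fun a => ?_
  by_contra! h2
  have hmem : a ∈ (paraOrtho μ n w).roots := Multiset.count_pos.1 (by omega)
  have ha := (mem_roots hN).1 hmem
  have ha0 : a ≠ 0 := by
    rintro rfl
    exact eval_zero_paraOrtho_ne_zero hμ hinf hn hw ha
  have hac := mem_circle_of_eval_paraOrtho hμ hinf hn hw ha0 ha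
  refine (isParaOrthogonal_paraOrtho hμ hinf n w).not_dvd hinf hN (natDegree_paraOrtho_le n w)
    ha0 ?_
  rw [conj_eq_inv_of_mem_circle hac, inv_inv, ← sq]
  rw [count_roots] at h2
  exact (le_rootMultiplicity_iff hN).1 h2

include hμ hinf in
/-- Consequence of the quadrature formula at the zeros of the para-orthogonal polynomial. -/
lemma integral_norm_sq_le_of_zeros {n : ℕ} (hn : 1 ≤ n) {w : ℂ}
    (hw : w ∈ Metric.sphere (0 : ℂ) 1) {p : ℂ[X]} (hp : p.degree < n) {ε : ℝ}
    (hε : ∀ z ∈ Metric.sphere (0 : ℂ) 1, (paraOrtho μ n w).eval z = 0 → ‖p.eval z‖ ^ 2 ≤ ε) :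
    ∫ z, ‖p.eval z‖ ^ 2 ∂μ ≤ ε := by
  classical
  set N := paraOrtho μ n w with hNdef
  have hN : N ≠ 0 := paraOrtho_ne_zero hμ hinf hn hw
  have hnd : N.roots.Nodup := nodup_roots_paraOrtho hμ hinf hn hw
  have hcard : N.roots.card = N.natDegree :=
    splits_iff_card_roots.1 (IsAlgClosed.splits N)
  set s := N.roots.toFinset with hs
  have hval : s.val = N.roots := by rw [hs, Multiset.toFinset_val, hnd.dedup]
  have hscard : s.card = n := by
    rw [Finset.card, hval, hcard, natDegree_paraOrtho hμ hinf hn hw]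
  have hroot : ∀ i ∈ s, i ∈ Metric.sphere (0 : ℂ) 1 ∧ N.eval i = 0 := fun i hi => by
    have h0 : N.eval i = 0 := (mem_roots hN).1 (Multiset.mem_toFinset.1 hi)
    refine ⟨mem_circle_of_eval_paraOrtho hμ hinf hn hw ?_ h0, h0⟩
    rintro rfl
    exact eval_zero_paraOrtho_ne_zero hμ hinf hn hw h0
  have hinj : Set.InjOn (id : ℂ → ℂ) s := Set.injOn_id _
  have hlc : N.leadingCoeff ≠ 0 := leadingCoeff_ne_zero.2 hN
  have hnodal : C N.leadingCoeff⁻¹ * N = Lagrange.nodal s id := by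
    have h1 := C_leadingCoeff_mul_prod_multiset_X_sub_C hcard
    rw [Lagrange.nodal, Finset.prod, hval]
    conv_lhs => enter [2]; rw [← h1]
    rw [← mul_assoc, ← C_mul, inv_mul_cancel₀ hlc, C_1, one_mul]
    rfl
  -- Each Lagrange basis polynomial is a multiple of `N / (X - i)`, and the others vanish at `i`.
  have horth : ∀ i ∈ s, ∀ j ∈ s, i ≠ j →
      polyForm μ hμ (Lagrange.basis s id i) (Lagrange.basis s id j) = 0 := by
    intro i hi j hj hij
    have hpara : IsParaOrthogonal μ hμ n
        ((Lagrange.nodalWeight s id i * N.leadingCoeff⁻¹) • N) := fun Q hQ => by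
      rw [LinearMap.map_smul, LinearMap.smul_apply,
        isParaOrthogonal_paraOrtho hμ hinf n w Q hQ, smul_zero]
    refine hpara.polyForm_eq_zero (hroot i hi).1 ?_ ?_
      (Lagrange.eval_basis_of_ne (v := id) hij.symm hi)
    · rw [Lagrange.basis_eq_prod_sub_inv_mul_nodal_div hi, ← Lagrange.nodal_erase_eq_nodal_div hi]
      rw [smul_eq_C_mul, C_mul, mul_assoc, hnodal, Lagrange.nodal_eq_mul_nodal_erase hi, id]
      ring
    · rw [Lagrange.degree_basis hinj hj, hscard]
      exact Nat.cast_lt.2 (by omega)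
  have hquad : ∀ P : ℂ[X], P.degree < n → ∫ z, ‖P.eval z‖ ^ 2 ∂μ =
      ∑ i ∈ s, ‖P.eval i‖ ^ 2 * ∫ z, ‖(Lagrange.basis s id i).eval z‖ ^ 2 ∂μ := by
    intro P hP
    have hPi : P = ∑ i ∈ s, P.eval i • Lagrange.basis s id i := by
      have := Lagrange.eq_interpolate hinj (f := P) (by rwa [hscard])
      simpa only [Lagrange.interpolate_apply, id, smul_eq_C_mul] using this
    rw [← Complex.ofReal_inj, ← polyForm_self hμ, Complex.ofReal_sum]
    conv_lhs => rw [hPi]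
    simp only [map_sum, LinearMap.sum_apply]
    refine Finset.sum_congr rfl fun i hi => ?_
    rw [Finset.sum_eq_single i]
    · rw [LinearMap.map_smul, LinearMap.smul_apply, LinearMap.map_smulₛₗ, Complex.ofReal_mul,
        ← polyForm_self hμ, ← Complex.normSq_eq_norm_sq, ← Complex.mul_conj, smul_eq_mul,
        smul_eq_mul, mul_assoc]
    · intro j hj hji
      rw [LinearMap.map_smul, LinearMap.smul_apply, LinearMap.map_smulₛₗ,
        horth j hj i hi hji, smul_zero, smul_zero]
    · exact fun h => absurd hi h
  -- The quadrature of `1` shows that the weights sum to 1.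
  have hone := hquad 1 (by rw [degree_one]; exact Nat.cast_lt.2 hn)
  simp only [eval_one, norm_one, one_pow, one_mul, integral_const, probReal_univ, smul_eq_mul,
    mul_one] at hone
  rw [hquad p hp]
  calc _ ≤ ∑ i ∈ s, ε * ∫ z, ‖(Lagrange.basis s id i).eval z‖ ^ 2 ∂μ :=
        Finset.sum_le_sum fun i hi => mul_le_mul_of_nonneg_right
          (hε i (hroot i hi).1 (hroot i hi).2) (integral_nonneg fun _ => by positivity)
    _ = ε := by rw [← Finset.mul_sum, ← hone, mul_one]

include hμ hinf in
/-- Consecutive para-orthogonal polynomials only share the prescribed zero. -/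
lemma eval_paraOrtho_succ_ne_zero {n : ℕ} (hn : 1 ≤ n) {w x : ℂ}
    (hw : w ∈ Metric.sphere (0 : ℂ) 1) (hx : x ∈ Metric.sphere (0 : ℂ) 1) (hxw : x ≠ w)
    (h : (paraOrtho μ n w).eval x = 0) : (paraOrtho μ (n + 1) w).eval x ≠ 0 := by
  intro h'
  obtain ⟨L, hL⟩ := dvd_iff_isRoot.2 (eval_paraOrtho_self (μ := μ) n w)
  obtain ⟨M, hM⟩ := dvd_iff_isRoot.2 (eval_paraOrtho_self (μ := μ) (n + 1) w)
  have hL0 : L ≠ 0 := right_ne_zero_of_mul (hL ▸ paraOrtho_ne_zero hμ hinf hn hw)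
  have hM0 : M ≠ 0 := right_ne_zero_of_mul (hM ▸ paraOrtho_ne_zero hμ hinf n.succ_pos hw)
  have hLx : L.eval x = 0 := by simpa [hL, sub_ne_zero.2 hxw] using h
  have hMx : M.eval x = 0 := by simpa [hM, sub_ne_zero.2 hxw] using h'
  have hLd : L.natDegree + 1 = n := by
    rw [← natDegree_paraOrtho hμ hinf hn hw, hL, natDegree_mul (X_sub_C_ne_zero w) hL0,
      natDegree_X_sub_C, add_comm]
  have hMd : M.natDegree = n := by
    have := natDegree_paraOrtho hμ hinf n.succ_pos hw
    rw [hM, natDegree_mul (X_sub_C_ne_zero w) hM0, natDegree_X_sub_C] at this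
    omega
  have hLp := fun p hp => (isParaOrthogonal_paraOrtho hμ hinf n w).polyForm_eq hn hw hL (p := p) hp
  have hMp := fun p hp => (isParaOrthogonal_paraOrtho hμ hinf (n + 1) w).polyForm_eq n.succ_pos
    hw hM (p := p) hp
  have hl : polyForm μ hμ L 1 ≠ 0 := fun h0 => hL0 (eq_zero_of_polyForm_self hμ hinf (by
    rw [hLp L (degree_le_natDegree.trans_lt (Nat.cast_lt.2 (by omega))), h0, mul_zero]))
  set d := polyForm μ hμ L 1 * M.coeff n with hd
  have hd0 : d ≠ 0 := by
    refine mul_ne_zero hl ?_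
    rw [← hMd, coeff_natDegree]
    exact leadingCoeff_ne_zero.2 hM0
  -- `L` and `M` are multiples of consecutive reproducing kernels at `w`, so a combination of them
  -- is a multiple of `Φ_n`: the constant `d` matches the coefficients of `X ^ n`. A common zero
  -- would then be a zero of `Φ_n` on the circle.
  set E := polyForm μ hμ L 1 • M - polyForm μ hμ M 1 • L - d • monicOrtho μ n with hE
  have hEdeg : E.degree < n := by
    refine (degree_lt_iff_coeff_zero _ _).2 fun m hm => ?_
    rcases hm.eq_or_lt with rfl | hlt
    · simp [hE, coeff_monicOrtho_self, coeff_eq_zero_of_natDegree_lt (p := L) (n := n) (by omega),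
        hd]
    · have hΦ := natDegree_monicOrtho (μ := μ) n
      simp [hE, coeff_eq_zero_of_natDegree_lt (p := L) (n := m) (by omega),
        coeff_eq_zero_of_natDegree_lt (p := M) (n := m) (by omega),
        coeff_eq_zero_of_natDegree_lt (p := monicOrtho μ n) (n := m) (by omega)]
  have hEp : ∀ p : ℂ[X], p.degree < n → polyForm μ hμ E p = 0 := fun p hp => by
    rw [hE, map_sub, map_sub, LinearMap.sub_apply, LinearMap.sub_apply, LinearMap.map_smul,
      LinearMap.map_smul, LinearMap.map_smul, LinearMap.smul_apply, LinearMap.smul_apply,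
      LinearMap.smul_apply, hLp p hp, hMp p (hp.trans (Nat.cast_lt.2 n.lt_succ_self)),
      polyForm_monicOrtho_of_degree_lt hμ hinf hp]
    simp only [smul_eq_mul]
    ring
  have hE0 : E = 0 := eq_zero_of_polyForm_self hμ hinf (hEp E hEdeg)
  have hEx := congrArg (eval x) hE0
  simp only [hE, eval_sub, eval_smul, hMx, hLx, smul_eq_mul, mul_zero, sub_self, eval_zero,
    zero_sub, neg_eq_zero, mul_eq_zero, hd0, false_or] at hEx
  exact eval_monicOrtho_ne_zero hμ hinf n hx hEx

end Zeros

/-! ### Accumulation of zeros at the support -/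

section Localization

lemma norm_sq_half_add_of_mem_circle {x z : ℂ} (hx : x ∈ Metric.sphere (0 : ℂ) 1)
    (hz : z ∈ Metric.sphere (0 : ℂ) 1) : ‖1 / 2 * (z + x)‖ ^ 2 = 1 - ‖z - x‖ ^ 2 / 4 := by
  have h := parallelogram_law_with_norm ℝ z x
  rw [mem_sphere_zero_iff_norm.1 hx, mem_sphere_zero_iff_norm.1 hz] at h
  rw [norm_mul, mul_pow]
  norm_num
  linarith

variable {μ : Measure ℂ} [IsProbabilityMeasure μ] (hμ : μ (Metric.sphere (0 : ℂ) 1)ᶜ = 0)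
  (hinf : μ.support.Infinite)

include hμ hinf in
lemma measureReal_ball_mul_le {n m : ℕ} (hmn : m < n) {w x : ℂ}
    (hw : w ∈ Metric.sphere (0 : ℂ) 1) (hx : x ∈ Metric.sphere (0 : ℂ) 1) {r : ℝ} (hr : 0 < r)
    (hr1 : r ≤ 1) (h : ∀ z ∈ Metric.ball x r, (paraOrtho μ n w).eval z ≠ 0) :
    μ.real (Metric.ball x (r / 2)) * (1 - r ^ 2 / 16) ^ m ≤ (1 - r ^ 2 / 4) ^ m := by
  -- A polynomial peaking at `x`: on the circle `|p|² = (1 - |z - x|² / 4) ^ m`, which is at most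
  -- `(1 - r² / 4) ^ m` at the nodes and at least `(1 - r² / 16) ^ m` on the half ball.
  set p : ℂ[X] := (C (1 / 2) * (X + C x)) ^ m with hpdef
  have hpd : p.degree < n := by
    refine degree_le_natDegree.trans_lt (Nat.cast_lt.2 (lt_of_le_of_lt ?_ hmn))
    refine natDegree_pow_le.trans ?_
    have := (natDegree_C_mul_le (1 / 2) (X + C x)).trans_eq (natDegree_X_add_C x)
    nlinarith
  have hp : ∀ z ∈ Metric.sphere (0 : ℂ) 1, ‖p.eval z‖ ^ 2 = (1 - ‖z - x‖ ^ 2 / 4) ^ m := by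
    intro z hz
    rw [← norm_sq_half_add_of_mem_circle hx hz, hpdef, eval_pow, norm_pow, pow_right_comm]
    simp
  have hnn : ∀ z ∈ Metric.sphere (0 : ℂ) 1, 0 ≤ 1 - ‖z - x‖ ^ 2 / 4 := fun z hz => by
    rw [← norm_sq_half_add_of_mem_circle hx hz]; positivity
  have hle : ∫ z, ‖p.eval z‖ ^ 2 ∂μ ≤ (1 - r ^ 2 / 4) ^ m := by
    refine integral_norm_sq_le_of_zeros hμ hinf (by omega) hw hpd fun z hz h0 => ?_
    rw [hp z hz]
    refine pow_le_pow_left₀ (hnn z hz) ?_ m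
    have hzr : r ≤ ‖z - x‖ := by
      by_contra! hlt
      exact h z (mem_ball_iff_norm.2 hlt) h0
    have := pow_le_pow_left₀ hr.le hzr 2
    linarith
  refine le_trans ?_ hle
  rw [← smul_eq_mul, ← integral_indicator_const _ Metric.isOpen_ball.measurableSet]
  refine integral_mono_ae ((integrable_const _).indicator Metric.isOpen_ball.measurableSet)
    (integrable_of_circle hμ (by fun_prop)) ?_
  filter_upwards [ae_mem_circle hμ] with z hz
  by_cases hzb : z ∈ Metric.ball x (r / 2)
  · rw [Set.indicator_of_mem hzb, hp z hz]
    have h1 := mem_ball_iff_norm.1 hzb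
    have h2 := pow_le_pow_left₀ (norm_nonneg _) h1.le 2
    refine pow_le_pow_left₀ ?_ ?_ m
    · nlinarith
    · linarith
  · rw [Set.indicator_of_notMem hzb]
    positivity

include hμ hinf in
/-- Every point of the support is an accumulation point of the zeros. -/
lemma accPt_of_mem_support {w x : ℂ} (hw : w ∈ Metric.sphere (0 : ℂ) 1) (hws : w ∉ μ.support)
    (hx : x ∈ μ.support) :
    AccPt x (Filter.principal {z | z ≠ 0 ∧ ∃ n, 1 ≤ n ∧ (paraOrtho μ n w).eval z = 0}) := by
  have hxc := support_subset_circle hμ hx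
  have hxw : x ≠ w := by rintro rfl; exact hws hx
  rw [accPt_iff_nhds]
  intro U hU
  obtain ⟨r₀, hr₀, hball⟩ := Metric.mem_nhds_iff.1 hU
  by_contra! hno
  set r := min r₀ 1 with hr
  have hrpos : 0 < r := lt_min hr₀ one_pos
  have hr1 : r ≤ 1 := min_le_right _ _
  have hzero : ∀ n, 1 ≤ n → ∀ z ∈ Metric.sphere (0 : ℂ) 1 ∩ Metric.ball x r,
      (paraOrtho μ n w).eval z = 0 → z = x := fun n hn z hz h0 =>
    hno z ⟨hball (Metric.ball_subset_ball (min_le_left _ _) hz.2),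
      ne_zero_of_mem_circle hz.1, n, hn, h0⟩
  have hfree : ∀ m : ℕ, ∃ n, m < n ∧ ∀ z ∈ Metric.ball x r, (paraOrtho μ n w).eval z ≠ 0 := by
    intro m
    obtain ⟨n, hmn, hn⟩ : ∃ n, m < n ∧ (paraOrtho μ n w).eval x ≠ 0 := by
      by_cases h : (paraOrtho μ (m + 1) w).eval x = 0
      · exact ⟨m + 2, by omega, eval_paraOrtho_succ_ne_zero hμ hinf (by omega) hw hxc hxw h⟩
      · exact ⟨m + 1, by omega, h⟩
    refine ⟨n, hmn, fun z hz h0 => hn ?_⟩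
    have hn1 : 1 ≤ n := by omega
    have hz0 : z ≠ 0 := by
      rintro rfl
      exact eval_zero_paraOrtho_ne_zero hμ hinf hn1 hw h0
    rwa [← hzero n hn1 z ⟨mem_circle_of_eval_paraOrtho hμ hinf hn1 hw hz0 h0, hz⟩ h0]
  have hβ : 0 < μ.real (Metric.ball x (r / 2)) :=
    ENNReal.toReal_pos ((Measure.mem_support_iff_forall x).1 hx _
      (Metric.ball_mem_nhds x (by positivity))).ne' (measure_ne_top _ _)
  have hrsq : r ^ 2 ≤ 1 := pow_le_one₀ hrpos.le hr1
  have hrsq0 : 0 < r ^ 2 := by positivity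
  have hden : 0 < 1 - r ^ 2 / 16 := by linarith
  obtain ⟨m, hm⟩ := exists_pow_lt_of_lt_one hβ
    (show (1 - r ^ 2 / 4) / (1 - r ^ 2 / 16) < 1 by rw [div_lt_one hden]; linarith)
  obtain ⟨n, hmn, hn⟩ := hfree m
  rw [div_pow, div_lt_iff₀ (pow_pos hden m)] at hm
  exact (measureReal_ball_mul_le hμ hinf hmn hw hxc hrpos hr1 hn).not_gt hm

end Localization

/-! ### Gaps of the support and the final argument -/

/-- Relatively open subsets of the circle have relatively open components. -/
lemma exists_ball_inter_circle_subset {F : Set ℂ} (hF : IsClosed F) {x : ℂ}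
    (hx : x ∈ Metric.sphere (0 : ℂ) 1 \ F) : ∃ r > 0, Metric.ball x r ∩ Metric.sphere (0 : ℂ) 1 ⊆
      connectedComponentIn (Metric.sphere (0 : ℂ) 1 \ F) x := by
  obtain ⟨δ, hδ, hball⟩ := Metric.mem_nhds_iff.1 (hF.isOpen_compl.mem_nhds hx.2)
  have hx1 := mem_sphere_zero_iff_norm.1 hx.1
  -- The radial projection moves points of the ball by less than `r`, so its image stays within `2r
  -- ≤ δ` of `x`; `r ≤ 1 / 2` keeps the origin out of the ball.
  set r := min (δ / 2) (1 / 2) with hr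
  have hrpos : 0 < r := lt_min (by positivity) (by norm_num)
  have hfix : ∀ y ∈ Metric.ball x r ∩ Metric.sphere (0 : ℂ) 1,
      y ∈ (fun z : ℂ => ‖z‖⁻¹ • z) '' Metric.ball x r := fun y hy =>
    ⟨y, hy.1, by simp only [mem_sphere_zero_iff_norm.1 hy.2, inv_one, one_smul]⟩
  have hnear : ∀ z ∈ Metric.ball x r, |1 - ‖z‖| < r := fun z hz => by
    rw [← hx1]
    refine (abs_norm_sub_norm_le x z).trans_lt ?_
    rw [← dist_eq_norm, dist_comm]
    exact hz
  have hpos : ∀ z ∈ Metric.ball x r, 0 < ‖z‖ := fun z hz => by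
    have h1 := (abs_lt.1 (hnear z hz)).2
    have h2 : r ≤ 1 / 2 := min_le_right _ _
    linarith
  refine ⟨r, hrpos, fun y hy => ?_⟩
  refine IsPreconnected.subset_connectedComponentIn
    (((convex_ball x r).isPreconnected).image _ ?_)
    (hfix x ⟨Metric.mem_ball_self hrpos, hx.1⟩) ?_ (hfix y hy)
  · exact (continuous_norm.continuousOn.inv₀ fun z hz => (hpos z hz).ne').smul continuousOn_id
  · rintro _ ⟨z, hz, rfl⟩
    have hz0 := hpos z hz
    refine ⟨?_, fun hmem => hball ?_ hmem⟩
    · rw [mem_sphere_zero_iff_norm, norm_smul, norm_inv, norm_norm, inv_mul_cancel₀ hz0.ne']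
    · rw [mem_ball_iff_norm]
      have h1 : ‖‖z‖⁻¹ • z - z‖ = |1 - ‖z‖| := by
        have : ‖z‖⁻¹ • z - z = ((1 - ‖z‖) * ‖z‖⁻¹) • z := by
          rw [sub_mul, mul_inv_cancel₀ hz0.ne', one_mul, sub_smul, one_smul]
        rw [this, norm_smul, norm_mul, norm_inv, norm_norm, mul_assoc, inv_mul_cancel₀ hz0.ne',
          mul_one, Real.norm_eq_abs]
      have h2 := mem_ball_iff_norm.1 hz
      have h3 := norm_sub_le_norm_sub_add_norm_sub (‖z‖⁻¹ • z) z x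
      have h4 := hnear z hz
      have h5 : r ≤ δ / 2 := min_le_left _ _
      linarith

lemma zeroSet_eq {μ : Measure ℂ} {q : ℕ → ℂ → ℂ} {w : ℂ} (hw : w ≠ 0)
    (hq : ∀ n z, q n z ^ 2 = z * w) : zeroSet μ q w =
      {z | z ≠ 0 ∧ ∃ n, 1 ≤ n ∧ (paraOrtho μ n w).eval z = 0} := by
  ext z
  refine and_congr_right fun hz => exists_congr fun n => and_congr_right fun _ => ?_
  -- A vanishing denominator would create spurious zeros, because division by zero gives zero.
  have hqn : q n z ≠ 0 := fun h => mul_ne_zero hz hw (by rw [← hq n z, h, zero_pow two_ne_zero])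
  rw [semiOrthoFun, ← eval_paraOrtho, div_eq_zero_iff,
    or_iff_left (mul_ne_zero Complex.I_ne_zero (pow_ne_zero n hqn))]

end

theorem theorem3 (μ : Measure ℂ) [IsProbabilityMeasure μ]
    (hμ : μ (Metric.sphere (0 : ℂ) 1)ᶜ = 0)
    (hinf : μ.support.Infinite)
    (hne : μ.support ≠ Metric.sphere (0 : ℂ) 1)
    {A : Type*} (C : A → Set ℂ)
    (hC : Set.range C = componentsOf (Metric.sphere (0 : ℂ) 1 \ μ.support))
    (w : A → ℂ) (hw : ∀ k, w k ∈ C k)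
    (q : A → ℕ → ℂ → ℂ) (hq : ∀ k n z, q k n z ^ 2 = z * w k) :
    μ.support = ⋂ k, derivedSet (zeroSet μ (q k) (w k)) := by
  have hsub := support_subset_circle hμ
  have hcomp : ∀ k, IsPreconnected (C k) ∧ C k ⊆ Metric.sphere (0 : ℂ) 1 \ μ.support := by
    intro k
    obtain ⟨x, _, hx⟩ : C k ∈ componentsOf _ := hC ▸ Set.mem_range_self k
    rw [hx]
    exact ⟨isPreconnected_connectedComponentIn, connectedComponentIn_subset _ _⟩
  have hwk : ∀ k, w k ∈ Metric.sphere (0 : ℂ) 1 \ μ.support := fun k => (hcomp k).2 (hw k)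
  have hZ := fun k => zeroSet_eq (μ := μ) (ne_zero_of_mem_circle (hwk k).1) (hq k)
  have hindex : ∀ x ∈ Metric.sphere (0 : ℂ) 1 \ μ.support,
      ∃ k, C k = connectedComponentIn (Metric.sphere (0 : ℂ) 1 \ μ.support) x := fun x hx => by
    have : connectedComponentIn (Metric.sphere (0 : ℂ) 1 \ μ.support) x ∈ Set.range C :=
      hC ▸ ⟨x, hx, rfl⟩
    exact this
  have hZc : ∀ k, zeroSet μ (q k) (w k) ⊆ Metric.sphere (0 : ℂ) 1 := by
    intro k z hz
    rw [hZ k] at hz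
    obtain ⟨hz0, n, hn, h0⟩ := hz
    exact mem_circle_of_eval_paraOrtho hμ hinf hn (hwk k).1 hz0 h0
  refine Set.Subset.antisymm (fun x hx => Set.mem_iInter.2 fun k => ?_) fun x hx => ?_
  · rw [hZ k]
    exact accPt_of_mem_support hμ hinf (hwk k).1 (hwk k).2 hx
  rw [Set.mem_iInter] at hx
  by_contra hxs
  -- At least one gap exists, so the intersection is not over an empty family and `x` lies on the
  -- circle.
  obtain ⟨y, hyc, hys⟩ := Set.exists_of_ssubset (hsub.ssubset_of_ne hne)
  obtain ⟨k₀, -⟩ := hindex y ⟨hyc, hys⟩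
  have hxc : x ∈ Metric.sphere (0 : ℂ) 1 :=
    (isClosed_iff_derivedSet_subset _).1 Metric.isClosed_sphere
      (derivedSet_mono _ _ (hZc k₀) (hx k₀))
  obtain ⟨k, hk⟩ := hindex x ⟨hxc, hxs⟩
  obtain ⟨r, hr, hball⟩ := exists_ball_inter_circle_subset Measure.isClosed_support ⟨hxc, hxs⟩
  rw [← hk] at hball
  have hmem : x ∈ C k := hball ⟨Metric.mem_ball_self hr, hxc⟩
  have hunique : ∀ z ∈ Metric.ball x r ∩ zeroSet μ (q k) (w k), z = w k := by
    rintro z ⟨hzb, hz⟩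
    have hzc := hball ⟨hzb, hZc k hz⟩
    rw [hZ k] at hz
    obtain ⟨-, n, hn, h0⟩ := hz
    exact eq_of_eval_paraOrtho_of_isPreconnected hμ hinf hn (hcomp k).1 (hcomp k).2 (hw k) hzc h0
  have hacc := accPt_iff_nhds.1 (hx k)
  by_cases hxw : x = w k
  · obtain ⟨z, hz, hzx⟩ := hacc _ (Metric.ball_mem_nhds x hr)
    exact hzx ((hunique z hz).trans hxw.symm)
  · obtain ⟨z, hz, -⟩ := hacc _ (Filter.inter_mem (Metric.ball_mem_nhds x hr)
      (isOpen_compl_singleton.mem_nhds hxw))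
    exact hz.1.2 (hunique z ⟨hz.1.1, hz.2⟩)
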